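/- All graphs are finite, simple and undirected. For a graph $G=(V,E)$ and an orientation of its edges, let $D$ be the $V\times E$ matrix with $D_{ve}=1$ if $v$ is the head of $e$, $D_{ve}=-1$ if $v$ is the tail of $e$, and $D_{ve}=0$ otherwise. The antisymmetric line graph $\mathcal A(G)$ is the signed graph with vertex set $E$ and signed adjacency matrix $D^{\mathsf T}D-2I$ (a nonzero entry $\pm1$ is an edge with that sign). Switching a signed graph at a vertex reverses the signs of all edges at that vertex; the switching class of a signed graph is the set of all signed graphs obtained from it by finite sequences of switchings. Reorienting edges of $G$ switches $\mathcal A(G)$, so the switching class of $\mathcal A(G)$ does not depend on the orientation. Two signed graphs are switching isomorphic if some member of the switching class of the first is isomorphic, with signs, to the second. Theorem. Let $G$ and $H$ be graphs such that $\mathcal A(G)$ and $\mathcal A(H)$ (formed with any orientations) are switching isomorphic. (1) If neither $G$ nor $H$ has an isolated vertex, then $G\cong H$. (2) In general, the graphs obtained from $G$ and $H$ by deleting all isolated vertices are isomorphic. Moreover, for the pair $K_3$, $K_{1,3}$: (3) Every signed graph in the switching class of $\mathcal A(K_3)$ and every signed graph in the switching class of $\mathcal A(K_{1,3})$ has a triangle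 as its underlying unsigned graph. The product of the three edge signs of this triangle is $-1$ for $\mathcal A(K_3)$ and $+1$ for $\mathcal A(K_{1,3})$. Consequently $\mathcal A(K_3)$ and $\mathcal A(K_{1,3})$ are not switching isomorphic. -/

import Mathlib

/-- A signed graph on the vertex set `V`, given by its signed adjacency matrix: a symmetric matrix
with zero diagonal and entries in `{0, 1, -1}`. A nonzero entry records an edge, and its value is
the sign of that edge. -/
structure SignedGraph (V : Type*) where
  adj : Matrix V V ℤ
  symm : ∀ u v, adj u v = adj v u
  diag : ∀ v, adj v v = 0
  entry : ∀ u v, adj u v = 0 ∨ adj u v = 1 ∨ adj u v = -1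

namespace SignedGraph

/-- The underlying unsigned graph. -/
def graph {V : Type*} (S : SignedGraph V) : SimpleGraph V where
  Adj u v := S.adj u v ≠ 0
  symm := ⟨fun u v h => by rwa [S.symm v u]⟩
  loopless := ⟨fun v h => h (S.diag v)⟩

/-- The sign of the triangle `a b c`: the product of the signs of its three edges. -/
def triangleSign {V : Type*} (S : SignedGraph V) (a b c : V) : ℤ :=
  S.adj a b * S.adj b c * S.adj c a

/-- Switching at the vertex `w`: the signs of all edges incident to `w` are reversed. -/
def switchAt {V : Type*} [DecidableEq V] (S : SignedGraph V) (w : V) : SignedGraph V where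
  adj u v := if u = w ∨ v = w then -S.adj u v else S.adj u v
  symm u v := by simp only [S.symm u v, or_comm]
  diag v := by simp [S.diag v]
  entry u v := by
    rcases S.entry u v with h | h | h <;> split_ifs <;> simp [h]

/-- `T` is obtained from `S` by a finite sequence of switchings at vertices. -/
def SwitchingEquiv {V : Type*} [DecidableEq V] (S T : SignedGraph V) : Prop :=
  Relation.ReflTransGen (fun S₁ S₂ => ∃ w, S₂ = S₁.switchAt w) S T

/-- The switching class of a signed graph. -/
def switchingClass {V : Type*} [DecidableEq V] (S : SignedGraph V) : Set (SignedGraph V) :=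
  {T | S.SwitchingEquiv T}

/-- Isomorphism of signed graphs: a bijection of the vertices that preserves adjacency and signs. -/
def Isomorphic {V W : Type*} (S : SignedGraph V) (T : SignedGraph W) : Prop :=
  ∃ φ : V ≃ W, ∀ u v, T.adj (φ u) (φ v) = S.adj u v

/-- `S` and `T` have the same switching class up to relabelling the vertices: some member of the
switching class of `S` is isomorphic to `T`. -/
def SwitchingIsomorphic {V W : Type*} [DecidableEq V] (S : SignedGraph V) (T : SignedGraph W) :
    Prop :=
  ∃ S' ∈ S.switchingClass, S'.Isomorphic T

end SignedGraph

/-- A reference orientation of `G`: each edge gets a tail and a head. -/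
structure EdgeOrientation {V : Type*} (G : SimpleGraph V) where
  tail : G.edgeSet → V
  head : G.edgeSet → V
  mk_eq : ∀ e : G.edgeSet, s(tail e, head e) = (e : Sym2 V)

namespace EdgeOrientation

/-- The oriented incidence matrix `D`. -/
def incidence {V : Type*} [DecidableEq V] {G : SimpleGraph V} (o : EdgeOrientation G) :
    Matrix V G.edgeSet ℤ :=
  Matrix.of fun v e => if v = o.head e then 1 else if v = o.tail e then -1 else 0

theorem tail_ne_head {V : Type*} {G : SimpleGraph V} (o : EdgeOrientation G) (e : G.edgeSet) :
    o.tail e ≠ o.head e := by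
  have h : G.Adj (o.tail e) (o.head e) := by
    rw [← SimpleGraph.mem_edgeSet, o.mk_eq]
    exact e.2
  exact h.ne

theorem gram_apply {V : Type*} [Fintype V] [DecidableEq V] {G : SimpleGraph V}
    (o : EdgeOrientation G) (e f : G.edgeSet) :
    (o.incidence.transpose * o.incidence) e f =
      (if o.head e = o.head f then 1 else if o.head e = o.tail f then -1 else 0) -
      (if o.tail e = o.head f then 1 else if o.tail e = o.tail f then -1 else 0) := by
  have hD : ∀ v, o.incidence v e =
      (if v = o.head e then 1 else 0) - (if v = o.tail e then 1 else 0) := by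
    intro v
    have := o.tail_ne_head e
    simp only [incidence, Matrix.of_apply]
    by_cases h1 : v = o.head e <;> by_cases h2 : v = o.tail e <;> simp [h1, h2] <;> grind
  simp only [Matrix.mul_apply, Matrix.transpose_apply, hD, sub_mul, ite_mul, one_mul, zero_mul,
    Finset.sum_sub_distrib, Finset.sum_ite_eq', Finset.mem_univ, if_true]
  simp [incidence]

/-- The antisymmetric line graph of `G`, computed with the reference orientation `o`: the signed
graph on the edges of `G` with signed adjacency matrix `Dᵀ D - 2 I`. -/
def antisymmetricLineGraph {V : Type*} [Fintype V] [DecidableEq V] {G : SimpleGraph V}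
    (o : EdgeOrientation G) : SignedGraph G.edgeSet where
  adj := o.incidence.transpose * o.incidence - (2 : ℤ) • (1 : Matrix G.edgeSet G.edgeSet ℤ)
  symm e f := by
    have h : (o.incidence.transpose * o.incidence) e f =
        (o.incidence.transpose * o.incidence) f e := by
      simp only [Matrix.mul_apply, Matrix.transpose_apply, mul_comm]
    simp only [Matrix.sub_apply, Matrix.smul_apply, h, Matrix.one_apply, eq_comm]
  diag e := by
    have := o.tail_ne_head e
    simp only [Matrix.sub_apply, Matrix.smul_apply, gram_apply, Matrix.one_apply]
    simp [this]
  entry e f := by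
    have he := o.tail_ne_head e
    have hf := o.tail_ne_head f
    have h1 := o.mk_eq e
    have h2 := o.mk_eq f
    simp only [Matrix.sub_apply, Matrix.smul_apply, gram_apply, Matrix.one_apply]
    by_cases hef : e = f
    · subst hef
      simp [he]
    · have h3 : s(o.tail e, o.head e) ≠ s(o.tail f, o.head f) := by
        rw [h1, h2]
        exact fun h => hef (Subtype.ext h)
      rw [Ne, Sym2.eq_iff] at h3
      simp only [hef, if_false, smul_zero, sub_zero]
      grind

end EdgeOrientation

/-!
The antisymmetric line graph remembers which sets of edges share a vertex. Switching conjugates the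
signed adjacency matrix by a diagonal matrix of signs, hence changes neither the underlying graph
nor the sign of a triangle. For three pairwise adjacent edges that sign is a product of entries of
the incidence matrix. If the edges meet in one vertex, each entry occurs squared and the sign is
`+1`; if they form a triangle of `G`, each edge contributes the product of the entries `1` and `-1`
of its column and the sign is `-1`. So a switching isomorphism is a bijection of edge sets that
preserves concurrency of triples of edges (`EdgeOrientation.concurrent_iff`).

Such a bijection `φ` is induced by an isomorphism away from the isolated vertices
(`SimpleGraph.nonempty_iso_of_concurrent_iff`). At each edge `e`, concurrency separates the edges
that meet `e` at one end from those that meet it at the other, so the ends of `e` can be matched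
with the ends of `φ e` compatibly with all other edges (`SimpleGraph.exists_endpoint_matching`).
Since two distinct edges have at most one common vertex, the matchings at different edges agree
wherever both are defined, and they glue to the required bijection of vertices. This is where
signs help: Whitney's theorem for ordinary line graphs has the exception `K₃`, `K₁,₃` because
there adjacency alone cannot tell three concurrent edges from a triangle.
-/

/-! ### Invariants of switching -/

namespace SignedGraph

variable {V W : Type*}

/-- Every member of a switching class is the conjugate of the signed adjacency matrix by a
diagonal matrix of signs. -/
theorem SwitchingEquiv.exists_sign [DecidableEq V] {S T : SignedGraph V}
    (h : S.SwitchingEquiv T) :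
    ∃ s : V → ℤ, (∀ v, s v * s v = 1) ∧ ∀ u v, T.adj u v = s u * s v * S.adj u v := by
  induction h with
  | refl => exact ⟨fun _ => 1, by simp, by simp⟩
  | tail _ h ih =>
    obtain ⟨s, hs, hT⟩ := ih
    obtain ⟨w, rfl⟩ := h
    refine ⟨fun v => if v = w then -s v else s v, fun v => ?_, fun u v => ?_⟩
    · by_cases hv : v = w <;> simp [hv, hs]
    · by_cases huv : u = v
      · subst huv
        simp [SignedGraph.diag]
      · by_cases hu : u = w <;> by_cases hv : v = w <;> simp_all [switchAt]

theorem SwitchingEquiv.adj_ne_zero_iff [DecidableEq V] {S T : SignedGraph V}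
    (h : S.SwitchingEquiv T) (u v : V) : T.adj u v ≠ 0 ↔ S.adj u v ≠ 0 := by
  obtain ⟨s, hs, hT⟩ := h.exists_sign
  have h0 : ∀ v, s v ≠ 0 := fun v h => by simpa [h] using hs v
  simp [hT, h0]

theorem SwitchingEquiv.triangleSign_eq [DecidableEq V] {S T : SignedGraph V}
    (h : S.SwitchingEquiv T) (a b c : V) : T.triangleSign a b c = S.triangleSign a b c := by
  obtain ⟨s, hs, hT⟩ := h.exists_sign
  simp only [triangleSign, hT]
  linear_combination (S.adj a b * S.adj b c * S.adj c a) *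
    (s b * s b * s c * s c * hs a + s c * s c * hs b + hs c)

theorem SwitchingIsomorphic.exists_equiv [DecidableEq V] {S : SignedGraph V} {T : SignedGraph W}
    (h : S.SwitchingIsomorphic T) :
    ∃ φ : V ≃ W, (∀ u v, T.adj (φ u) (φ v) ≠ 0 ↔ S.adj u v ≠ 0) ∧
      ∀ a b c, T.triangleSign (φ a) (φ b) (φ c) = S.triangleSign a b c := by
  obtain ⟨S', hS, φ, hφ⟩ := h
  refine ⟨φ, fun u v => ?_, fun a b c => ?_⟩
  · rw [hφ, SwitchingEquiv.adj_ne_zero_iff hS]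
  · rw [← SwitchingEquiv.triangleSign_eq hS]
    simp only [triangleSign, hφ]

end SignedGraph

/-! ### Concurrent edges and triangle signs -/

namespace SimpleGraph

/-- Three (not necessarily distinct) edges are concurrent if some vertex lies on all of them. -/
def Concurrent {V : Type*} {G : SimpleGraph V} (e f g : G.edgeSet) : Prop :=
  ∃ v, v ∈ (e : Sym2 V) ∧ v ∈ (f : Sym2 V) ∧ v ∈ (g : Sym2 V)

end SimpleGraph

namespace EdgeOrientation

variable {V : Type*} {G : SimpleGraph V} (o : EdgeOrientation G)

theorem mem_iff (e : G.edgeSet) (v : V) : v ∈ (e : Sym2 V) ↔ v = o.tail e ∨ v = o.head e := by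
  rw [← o.mk_eq, Sym2.mem_iff]

variable [DecidableEq V]

theorem incidence_mul_self {e : G.edgeSet} {v : V} (hv : v ∈ (e : Sym2 V)) :
    o.incidence v e * o.incidence v e = 1 := by
  rw [o.mem_iff] at hv
  simp only [incidence, Matrix.of_apply]
  grind

/-- The two nonzero entries of a column of the incidence matrix are opposite. -/
theorem incidence_mul_incidence {e : G.edgeSet} {u v : V} (hu : u ∈ (e : Sym2 V))
    (hv : v ∈ (e : Sym2 V)) (huv : u ≠ v) : o.incidence u e * o.incidence v e = -1 := by
  rw [o.mem_iff] at hu hv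
  simp only [incidence, Matrix.of_apply]
  grind

variable [Fintype V]

theorem adj_eq_gram {e f : G.edgeSet} (hef : e ≠ f) : o.antisymmetricLineGraph.adj e f =
    (if o.head e = o.head f then 1 else if o.head e = o.tail f then -1 else 0) -
      (if o.tail e = o.head f then 1 else if o.tail e = o.tail f then -1 else 0) := by
  rw [← o.gram_apply]
  simp only [antisymmetricLineGraph, Matrix.sub_apply, Matrix.smul_apply, Matrix.one_apply_ne hef,
    smul_zero, sub_zero]

/-- Distinct edges have at most one common vertex, so only one term of the scalar product of their
columns survives. -/
theorem adj_eq_of_mem {e f : G.edgeSet} (hef : e ≠ f) {v : V} (he : v ∈ (e : Sym2 V))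
    (hf : v ∈ (f : Sym2 V)) :
    o.antisymmetricLineGraph.adj e f = o.incidence v e * o.incidence v f := by
  have h3 : s(o.tail e, o.head e) ≠ s(o.tail f, o.head f) := by
    rw [o.mk_eq, o.mk_eq]
    exact fun h => hef (Subtype.ext h)
  rw [Ne, Sym2.eq_iff] at h3
  have h1 := o.tail_ne_head e
  have h2 := o.tail_ne_head f
  rw [o.mem_iff] at he hf
  rw [o.adj_eq_gram hef]
  simp only [incidence, Matrix.of_apply]
  grind

theorem adj_ne_zero_iff (e f : G.edgeSet) : o.antisymmetricLineGraph.adj e f ≠ 0 ↔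
    e ≠ f ∧ ∃ v, v ∈ (e : Sym2 V) ∧ v ∈ (f : Sym2 V) := by
  constructor
  · intro h
    have hef : e ≠ f := by
      rintro rfl
      exact h (SignedGraph.diag _ _)
    refine ⟨hef, ?_⟩
    rw [o.adj_eq_gram hef] at h
    simp only [o.mem_iff]
    by_contra! hc
    have hh := hc (o.head e) (Or.inr rfl)
    have ht := hc (o.tail e) (Or.inl rfl)
    simp [hh, ht] at h
  · rintro ⟨hef, v, he, hf⟩ h
    rw [o.adj_eq_of_mem hef he hf] at h
    have h1 := o.incidence_mul_self he
    have h2 := o.incidence_mul_self hf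
    rcases mul_eq_zero.mp h with h | h <;> simp [h] at h1 h2

theorem triangleSign_of_concurrent {e f g : G.edgeSet} (hef : e ≠ f) (hfg : f ≠ g) (hge : g ≠ e)
    (h : SimpleGraph.Concurrent e f g) :
    o.antisymmetricLineGraph.triangleSign e f g = 1 := by
  obtain ⟨v, he, hf, hg⟩ := h
  rw [SignedGraph.triangleSign, o.adj_eq_of_mem hef he hf, o.adj_eq_of_mem hfg hf hg,
    o.adj_eq_of_mem hge hg he]
  have h1 := o.incidence_mul_self he
  have h2 := o.incidence_mul_self hf
  have h3 := o.incidence_mul_self hg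
  generalize o.incidence v e = x at *
  generalize o.incidence v f = y at *
  generalize o.incidence v g = z at *
  linear_combination y * y * z * z * h1 + z * z * h2 + h3

/-- Three pairwise adjacent edges without a common vertex form a triangle of `G`; each of them
contributes a factor `-1`, the product of the two nonzero entries of its column. -/
theorem triangleSign_of_not_concurrent {e f g : G.edgeSet}
    (hef : o.antisymmetricLineGraph.adj e f ≠ 0) (hfg : o.antisymmetricLineGraph.adj f g ≠ 0)
    (hge : o.antisymmetricLineGraph.adj g e ≠ 0) (h : ¬ SimpleGraph.Concurrent e f g) :
    o.antisymmetricLineGraph.triangleSign e f g = -1 := by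
  obtain ⟨hef, u, hue, huf⟩ := (o.adj_ne_zero_iff _ _).mp hef
  obtain ⟨hfg, v, hvf, hvg⟩ := (o.adj_ne_zero_iff _ _).mp hfg
  obtain ⟨hge, w, hwg, hwe⟩ := (o.adj_ne_zero_iff _ _).mp hge
  have huv : u ≠ v := by
    rintro rfl
    exact h ⟨u, hue, huf, hvg⟩
  have hvw : v ≠ w := by
    rintro rfl
    exact h ⟨v, hwe, hvf, hvg⟩
  have hwu : w ≠ u := by
    rintro rfl
    exact h ⟨w, hwe, huf, hwg⟩
  rw [SignedGraph.triangleSign, o.adj_eq_of_mem hef hue huf, o.adj_eq_of_mem hfg hvf hvg,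
    o.adj_eq_of_mem hge hwg hwe]
  have h1 := o.incidence_mul_incidence hwe hue hwu
  have h2 := o.incidence_mul_incidence huf hvf huv
  have h3 := o.incidence_mul_incidence hvg hwg hvw
  calc _ = (o.incidence w e * o.incidence u e) * (o.incidence u f * o.incidence v f) *
        (o.incidence v g * o.incidence w g) := by ring
    _ = -1 := by rw [h1, h2, h3]; norm_num

/-- Concurrency of edges of `G` is expressed by the switching invariants of the antisymmetric line
graph: its underlying graph and the signs of its triangles. -/
theorem concurrent_iff (e f g : G.edgeSet) : SimpleGraph.Concurrent e f g ↔
    (e = f ∨ o.antisymmetricLineGraph.adj e f ≠ 0) ∧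
    (f = g ∨ o.antisymmetricLineGraph.adj f g ≠ 0) ∧
    (g = e ∨ o.antisymmetricLineGraph.adj g e ≠ 0) ∧
    (e ≠ f → f ≠ g → g ≠ e → o.antisymmetricLineGraph.triangleSign e f g = 1) := by
  constructor
  · intro h
    refine ⟨?_, ?_, ?_, fun hef hfg hge => o.triangleSign_of_concurrent hef hfg hge h⟩ <;>
      obtain ⟨v, he, hf, hg⟩ := h <;> simp only [o.adj_ne_zero_iff] <;> grind
  · rintro ⟨h1, h2, h3, h4⟩
    by_cases hef : e = f
    · subst hef
      rcases h2 with rfl | h2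
      · exact ⟨o.head e, by simp [o.mem_iff]⟩
      · obtain ⟨-, v, h⟩ := (o.adj_ne_zero_iff _ _).mp h2
        exact ⟨v, h.1, h⟩
    by_cases hfg : f = g
    · subst hfg
      obtain ⟨-, v, h⟩ := (o.adj_ne_zero_iff _ _).mp (h1.resolve_left hef)
      exact ⟨v, h.1, h.2, h.2⟩
    by_cases hge : g = e
    · subst hge
      obtain ⟨-, v, h⟩ := (o.adj_ne_zero_iff _ _).mp (h1.resolve_left hef)
      exact ⟨v, h.1, h.2, h.1⟩
    by_contra hc
    have := o.triangleSign_of_not_concurrent (h1.resolve_left hef) (h2.resolve_left hfg)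
      (h3.resolve_left hge) hc
    rw [h4 hef hfg hge] at this
    norm_num at this

end EdgeOrientation

/-! ### Edge bijections that preserve concurrency -/

namespace SimpleGraph

variable {V W : Type*} {G : SimpleGraph V} {H : SimpleGraph W}

theorem eq_of_mem_of_mem {e f : G.edgeSet} (hef : e ≠ f) {u v : V} (hue : u ∈ (e : Sym2 V))
    (huf : u ∈ (f : Sym2 V)) (hve : v ∈ (e : Sym2 V)) (hvf : v ∈ (f : Sym2 V)) : u = v := by
  by_contra huv
  apply hef
  ext1
  rw [(Sym2.mem_and_mem_iff huv).mp ⟨hue, hve⟩, (Sym2.mem_and_mem_iff huv).mp ⟨huf, hvf⟩]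

/-- The ends of an edge are matched with the ends of its image: two other edges that meet `e` meet
it at the same end exactly if the three are concurrent, so a concurrency-preserving map carries
the edges at one end of `e` to the edges at one end of `φ e`. -/
theorem exists_endpoint_matching (φ : G.edgeSet ≃ H.edgeSet)
    (hφ : ∀ e f g, Concurrent (φ e) (φ f) (φ g) ↔ Concurrent e f g) (e : G.edgeSet) :
    ∃ m : V → W, (∀ v ∈ (e : Sym2 V), m v ∈ (φ e : Sym2 W)) ∧
      (∀ u ∈ (e : Sym2 V), ∀ v ∈ (e : Sym2 V), m u = m v → u = v) ∧
      ∀ v ∈ (e : Sym2 V), ∀ f ≠ e, (m v ∈ (φ f : Sym2 W) ↔ v ∈ (f : Sym2 V)) := by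
  classical
  obtain ⟨⟨u, v⟩, hG⟩ := e
  change G.Adj u v at hG
  set e : G.edgeSet := ⟨s(u, v), hG⟩ with he
  have huv := hG.ne
  have hmem : ∀ x, x ∈ (e : Sym2 V) ↔ x = u ∨ x = v := by simp [he]
  -- It suffices to name the image `a` of `u` and the image `b` of `v`.
  suffices ∃ a b, a ≠ b ∧ (φ e : Sym2 W) = s(a, b) ∧
      ∀ f ≠ e, (a ∈ (φ f : Sym2 W) ↔ u ∈ (f : Sym2 V)) ∧
        (b ∈ (φ f : Sym2 W) ↔ v ∈ (f : Sym2 V)) by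
    obtain ⟨a, b, hab, h1, h2⟩ := this
    refine ⟨fun x => if x = u then a else b, ?_, ?_, ?_⟩
    · intro x _
      rw [h1, Sym2.mem_iff]
      grind
    · intro x hx y hy
      rw [hmem] at hx hy
      grind
    · intro x hx f hf
      rw [hmem] at hx
      have := h2 f hf
      grind
  -- An edge at `u`, other than `e`, forces the choice of `a`, hence all of the matching.
  have key : ∀ u v, u ≠ v → (e : Sym2 V) = s(u, v) → ∀ f ≠ e, u ∈ (f : Sym2 V) →
      ∃ a b, a ≠ b ∧ (φ e : Sym2 W) = s(a, b) ∧
        ∀ g ≠ e, (a ∈ (φ g : Sym2 W) ↔ u ∈ (g : Sym2 V)) ∧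
          (b ∈ (φ g : Sym2 W) ↔ v ∈ (g : Sym2 V)) := by
    intro u v huv he f hf huf
    have hue : u ∈ (e : Sym2 V) := by simp [he]
    have hve : v ∈ (e : Sym2 V) := by simp [he]
    obtain ⟨a, ha, ha', -⟩ := (hφ e f f).mpr ⟨u, hue, huf, huf⟩
    obtain ⟨b, hb⟩ := Sym2.mem_iff_exists.mp ha
    have hab : a ≠ b := by
      have := (φ e).2
      rw [hb] at this
      exact H.ne_of_adj this
    have hbe : b ∈ (φ e : Sym2 W) := by simp [hb]
    have haiff : ∀ g ≠ e, (a ∈ (φ g : Sym2 W) ↔ u ∈ (g : Sym2 V)) := by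
      intro g hg
      constructor
      · intro h
        obtain ⟨x, h1, h2, h3⟩ := (hφ e f g).mp ⟨a, ha, ha', h⟩
        rwa [eq_of_mem_of_mem hf.symm hue huf h1 h2]
      · intro h
        obtain ⟨x, h1, h2, h3⟩ := (hφ e f g).mpr ⟨u, hue, huf, h⟩
        rwa [eq_of_mem_of_mem (φ.injective.ne hf.symm) ha ha' h1 h2]
    refine ⟨a, b, hab, hb, fun g hg => ⟨haiff g hg, ?_⟩⟩
    constructor
    · intro h
      obtain ⟨x, h1, h2, -⟩ := (hφ e g g).mp ⟨b, hbe, h, h⟩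
      rw [he, Sym2.mem_iff] at h1
      rcases h1 with rfl | rfl
      · exact absurd (eq_of_mem_of_mem (φ.injective.ne hg.symm) ha ((haiff g hg).mpr h2) hbe h) hab
      · exact h2
    · intro h
      obtain ⟨x, h1, h2, -⟩ := (hφ e g g).mpr ⟨v, hve, h, h⟩
      rw [hb, Sym2.mem_iff] at h1
      rcases h1 with rfl | rfl
      · exact absurd (eq_of_mem_of_mem hg.symm hue ((haiff g hg).mp h2) hve h) huv
      · exact h2
  by_cases hu : ∃ f ≠ e, u ∈ (f : Sym2 V)
  · obtain ⟨f, hf, hu⟩ := hu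
    exact key u v huv rfl f hf hu
  by_cases hv : ∃ f ≠ e, v ∈ (f : Sym2 V)
  · obtain ⟨f, hf, hv⟩ := hv
    obtain ⟨b, a, hab, h1, h2⟩ := key v u huv.symm Sym2.eq_swap f hf hv
    exact ⟨a, b, hab.symm, h1.trans Sym2.eq_swap, fun g hg => (h2 g hg).symm⟩
  -- Otherwise `e` is a component of its own, and so is `φ e`: either matching will do.
  push Not at hu hv
  obtain ⟨a, b, hab⟩ : ∃ a b, (φ e : Sym2 W) = s(a, b) := Sym2.exists.mp ⟨_, rfl⟩
  have hH := (φ e).2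
  rw [hab] at hH
  have hdisj : ∀ f ≠ e, ∀ x ∈ (φ e : Sym2 W), x ∉ (φ f : Sym2 W) := by
    intro f hf x hx hx'
    obtain ⟨y, h1, h2, -⟩ := (hφ e f f).mp ⟨x, hx, hx', hx'⟩
    rcases (hmem y).mp h1 with rfl | rfl
    · exact hu f hf h2
    · exact hv f hf h2
  refine ⟨a, b, H.ne_of_adj hH, hab, fun f hf => ⟨?_, ?_⟩⟩
  · exact iff_of_false (hdisj f hf a (by simp [hab])) (hu f hf)
  · exact iff_of_false (hdisj f hf b (by simp [hab])) (hv f hf)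

theorem exists_mem_edge {v : V} (hv : ¬ G.IsIsolated v) : ∃ e : G.edgeSet, v ∈ (e : Sym2 V) := by
  simp only [IsIsolated, not_forall, not_not] at hv
  obtain ⟨w, hw⟩ := hv
  exact ⟨⟨s(v, w), hw⟩, by simp⟩

theorem not_isIsolated_of_mem {v : V} {e : G.edgeSet} (hv : v ∈ (e : Sym2 V)) :
    ¬ G.IsIsolated v := by
  obtain ⟨w, hw⟩ := Sym2.mem_iff_exists.mp hv
  have h := e.2
  rw [hw] at h
  exact fun hi => hi w h

/-- A bijection of edge sets that preserves concurrency is induced by an isomorphism away from the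
isolated vertices. -/
theorem nonempty_iso_of_concurrent_iff (φ : G.edgeSet ≃ H.edgeSet)
    (hφ : ∀ e f g, Concurrent (φ e) (φ f) (φ g) ↔ Concurrent e f g) :
    Nonempty (G.induce {v | ¬ G.IsIsolated v} ≃g H.induce {w | ¬ H.IsIsolated w}) := by
  choose m hm hinj hiff using exists_endpoint_matching φ hφ
  -- The matchings at two edges through `v` agree at `v`, and so glue to a map `ψ` of vertices.
  have hglue : ∀ (e f : G.edgeSet) v, v ∈ (e : Sym2 V) → v ∈ (f : Sym2 V) → m e v = m f v := by
    intro e f v he hf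
    by_cases hef : e = f
    · rw [hef]
    · exact eq_of_mem_of_mem (φ.injective.ne hef) (hm e v he)
        ((hiff e v he f (Ne.symm hef)).mpr hf) ((hiff f v hf e hef).mpr he) (hm f v hf)
  choose E hE using fun v : {v | ¬ G.IsIsolated v} => exists_mem_edge v.2
  let ψ : {v | ¬ G.IsIsolated v} → {w | ¬ H.IsIsolated w} := fun v =>
    ⟨m (E v) v, not_isIsolated_of_mem (hm _ _ (hE v))⟩
  have hψ : ∀ v (e : G.edgeSet), v.1 ∈ (e : Sym2 V) → (ψ v : W) = m e v := fun v e he =>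
    hglue _ _ _ (hE v) he
  have hψinj : Function.Injective ψ := by
    intro u v huv
    have huv' : (ψ u : W) = ψ v := congrArg _ huv
    have huf : u.1 ∈ (E v : Sym2 V) := by
      by_cases hef : E v = E u
      · rw [hef]
        exact hE u
      · refine (hiff (E u) u (hE u) (E v) hef).mp ?_
        change (ψ u : W) ∈ _
        rw [huv']
        exact hm _ _ (hE v)
    exact Subtype.ext (hinj (E v) _ huf _ (hE v) (by rw [← hψ u _ huf, huv']))
  have hψedge : ∀ (u v : {v | ¬ G.IsIsolated v}) (e : G.edgeSet), (e : Sym2 V) = s(u.1, v.1) →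
      (φ e : Sym2 W) = s((ψ u).1, (ψ v).1) := by
    intro u v e he
    have hu : u.1 ∈ (e : Sym2 V) := by simp [he]
    have hv : v.1 ∈ (e : Sym2 V) := by simp [he]
    have huv : u ≠ v := by
      rintro rfl
      have := e.2
      rw [he] at this
      exact G.ne_of_adj this rfl
    have hne : (ψ u).1 ≠ (ψ v).1 := fun h => huv (hψinj (Subtype.ext h))
    rw [← Sym2.mem_and_mem_iff hne, hψ u e hu, hψ v e hv]
    exact ⟨hm _ _ hu, hm _ _ hv⟩
  have hends : ∀ e : G.edgeSet, ∃ u v : {v | ¬ G.IsIsolated v}, (e : Sym2 V) = s(u.1, v.1) := by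
    intro e
    obtain ⟨u, v, huv⟩ : ∃ a b, (e : Sym2 V) = s(a, b) := Sym2.exists.mp ⟨_, rfl⟩
    exact ⟨⟨u, not_isIsolated_of_mem (e := e) (by simp [huv])⟩,
      ⟨v, not_isIsolated_of_mem (e := e) (by simp [huv])⟩, huv⟩
  have hψsurj : Function.Surjective ψ := by
    intro w
    obtain ⟨e', he'⟩ := exists_mem_edge w.2
    obtain ⟨e, rfl⟩ := φ.surjective e'
    obtain ⟨u, v, huv⟩ := hends e
    rw [hψedge u v e huv, Sym2.mem_iff] at he'
    rcases he' with h | h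
    · exact ⟨u, Subtype.ext h.symm⟩
    · exact ⟨v, Subtype.ext h.symm⟩
  refine ⟨⟨Equiv.ofBijective ψ ⟨hψinj, hψsurj⟩, ?_⟩⟩
  intro u v
  simp only [comap_adj, Function.Embedding.subtype_apply]
  constructor
  · intro h
    obtain ⟨e, he⟩ := φ.surjective ⟨s((ψ u).1, (ψ v).1), h⟩
    obtain ⟨x, y, hxy⟩ := hends e
    have h1 := hψedge x y e hxy
    rw [he] at h1
    have h2 := e.2
    rw [hxy] at h2
    rcases Sym2.eq_iff.mp h1 with ⟨ha, hb⟩ | ⟨ha, hb⟩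
    · rw [hψinj (Subtype.ext ha), hψinj (Subtype.ext hb)]
      exact h2
    · rw [hψinj (Subtype.ext ha), hψinj (Subtype.ext hb)]
      exact G.adj_symm h2
  · intro h
    have h1 := (φ ⟨s(u.1, v.1), h⟩).2
    rw [hψedge u v _ rfl] at h1
    exact h1

end SimpleGraph

/-! ### Reconstruction, and the pair `K₃`, `K₁,₃` -/

namespace EdgeOrientation

theorem nonempty_induce_iso {V W : Type*} [Fintype V] [DecidableEq V] [Fintype W] [DecidableEq W]
    {G : SimpleGraph V} {H : SimpleGraph W} (o : EdgeOrientation G) (p : EdgeOrientation H)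
    (h : o.antisymmetricLineGraph.SwitchingIsomorphic p.antisymmetricLineGraph) :
    Nonempty (G.induce {v | ¬ G.IsIsolated v} ≃g H.induce {w | ¬ H.IsIsolated w}) := by
  obtain ⟨φ, hadj, hsign⟩ := h.exists_equiv
  refine SimpleGraph.nonempty_iso_of_concurrent_iff φ fun e f g => ?_
  simp only [o.concurrent_iff, p.concurrent_iff, hadj, hsign, ne_eq, φ.injective.eq_iff]

/-- If all edges of `G` are pairwise adjacent, each member of the switching class has a complete
underlying graph. -/
theorem nonempty_iso_top {V : Type*} [Fintype V] [DecidableEq V] {G : SimpleGraph V}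
    (o : EdgeOrientation G) {n : ℕ} (hn : Nat.card G.edgeSet = n)
    (hG : ∀ e f : G.edgeSet, ∃ v, v ∈ (e : Sym2 V) ∧ v ∈ (f : Sym2 V))
    {S : SignedGraph G.edgeSet} (hS : S ∈ o.antisymmetricLineGraph.switchingClass) :
    Nonempty (S.graph ≃g (⊤ : SimpleGraph (Fin n))) := by
  refine ⟨⟨Finite.equivFinOfCardEq hn, ?_⟩⟩
  intro e f
  change _ ↔ S.adj e f ≠ 0
  rw [SignedGraph.SwitchingEquiv.adj_ne_zero_iff hS, o.adj_ne_zero_iff]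
  simp [hG]

theorem triangleSign_of_mem_switchingClass {V : Type*} [Fintype V] [DecidableEq V]
    {G : SimpleGraph V} (o : EdgeOrientation G) {S : SignedGraph G.edgeSet}
    (hS : S ∈ o.antisymmetricLineGraph.switchingClass) {e f g : G.edgeSet}
    (hef : S.graph.Adj e f) (hfg : S.graph.Adj f g) (hge : S.graph.Adj g e) :
    (SimpleGraph.Concurrent e f g → S.triangleSign e f g = 1) ∧
      (¬ SimpleGraph.Concurrent e f g → S.triangleSign e f g = -1) := by
  rw [SignedGraph.SwitchingEquiv.triangleSign_eq hS]
  exact ⟨o.triangleSign_of_concurrent hef.ne hfg.ne hge.ne, o.triangleSign_of_not_concurrent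
    ((SignedGraph.SwitchingEquiv.adj_ne_zero_iff hS _ _).mp hef)
    ((SignedGraph.SwitchingEquiv.adj_ne_zero_iff hS _ _).mp hfg)
    ((SignedGraph.SwitchingEquiv.adj_ne_zero_iff hS _ _).mp hge)⟩

theorem triangleSign_of_top (o : EdgeOrientation (⊤ : SimpleGraph (Fin 3)))
    {S : SignedGraph (⊤ : SimpleGraph (Fin 3)).edgeSet}
    (hS : S ∈ o.antisymmetricLineGraph.switchingClass) :
    Nonempty (S.graph ≃g (⊤ : SimpleGraph (Fin 3))) ∧
      ∀ a b c, S.graph.Adj a b → S.graph.Adj b c → S.graph.Adj c a →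
        S.triangleSign a b c = -1 := by
  refine ⟨o.nonempty_iso_top ?_ ?_ hS, fun a b c hab hbc hca =>
    (o.triangleSign_of_mem_switchingClass hS hab hbc hca).2 ?_⟩
  · rw [Nat.card_eq_fintype_card, ← SimpleGraph.edgeFinset_card,
      SimpleGraph.card_edgeFinset_top_eq_card_choose_two]
    rfl
  · decide
  · have h1 := hab.ne
    have h2 := hbc.ne
    have h3 := hca.ne
    clear hab hbc hca hS
    rintro ⟨v, ha, hb, hc⟩
    clear S
    revert a b c v
    clear o
    decide

theorem triangleSign_of_star (p : EdgeOrientation (completeBipartiteGraph (Fin 1) (Fin 3)))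
    {T : SignedGraph (completeBipartiteGraph (Fin 1) (Fin 3)).edgeSet}
    (hT : T ∈ p.antisymmetricLineGraph.switchingClass) :
    Nonempty (T.graph ≃g (⊤ : SimpleGraph (Fin 3))) ∧
      ∀ a b c, T.graph.Adj a b → T.graph.Adj b c → T.graph.Adj c a →
        T.triangleSign a b c = 1 := by
  have hspoke : ∀ e : (completeBipartiteGraph (Fin 1) (Fin 3)).edgeSet,
      ∃ i, s(Sum.inl 0, Sum.inr i) = (e : Sym2 (Fin 1 ⊕ Fin 3)) := by
    rintro ⟨⟨i | i, j | j⟩, h⟩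
    · simp at h
    · exact ⟨j, by rw [Subsingleton.elim i 0]⟩
    · exact ⟨i, by rw [Subsingleton.elim j 0]; exact Sym2.eq_swap⟩
    · simp at h
  have hmem : ∀ e : (completeBipartiteGraph (Fin 1) (Fin 3)).edgeSet,
      Sum.inl 0 ∈ (e : Sym2 (Fin 1 ⊕ Fin 3)) := by
    intro e
    obtain ⟨i, hi⟩ := hspoke e
    simp [← hi]
  refine ⟨p.nonempty_iso_top ?_ (fun e f => ⟨_, hmem e, hmem f⟩) hT, fun a b c hab hbc hca =>
    (p.triangleSign_of_mem_switchingClass hT hab hbc hca).1 ⟨_, hmem a, hmem b, hmem c⟩⟩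
  let spoke : Fin 3 → (completeBipartiteGraph (Fin 1) (Fin 3)).edgeSet := fun i =>
    ⟨s(Sum.inl 0, Sum.inr i), by simp⟩
  have hbij : Function.Bijective spoke := by
    refine ⟨fun i j hij => ?_, fun e => ?_⟩
    · simpa [spoke] using hij
    · obtain ⟨i, hi⟩ := hspoke e
      exact ⟨i, Subtype.ext hi⟩
  rw [← Nat.card_eq_of_bijective spoke hbij, Nat.card_fin]

end EdgeOrientation

theorem theorem5 :
    -- Graphs without isolated vertices are determined up to isomorphism.
    (∀ {V W : Type*} [Fintype V] [DecidableEq V] [Fintype W] [DecidableEq W]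
      (G : SimpleGraph V) (H : SimpleGraph W) (o : EdgeOrientation G) (p : EdgeOrientation H),
      (∀ v, ¬ G.IsIsolated v) → (∀ w, ¬ H.IsIsolated w) →
      o.antisymmetricLineGraph.SwitchingIsomorphic p.antisymmetricLineGraph →
      Nonempty (G ≃g H)) ∧
    -- Arbitrary graphs are determined up to isomorphism after deleting the isolated vertices.
    (∀ {V W : Type*} [Fintype V] [DecidableEq V] [Fintype W] [DecidableEq W]
      (G : SimpleGraph V) (H : SimpleGraph W) (o : EdgeOrientation G) (p : EdgeOrientation H),
      o.antisymmetricLineGraph.SwitchingIsomorphic p.antisymmetricLineGraph →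
      Nonempty (G.induce {v | ¬ G.IsIsolated v} ≃g H.induce {w | ¬ H.IsIsolated w})) ∧
    -- In the switching class for `K₃`, each member is a triangle, and that triangle is negative.
    (∀ o : EdgeOrientation (⊤ : SimpleGraph (Fin 3)),
      ∀ S ∈ o.antisymmetricLineGraph.switchingClass,
        Nonempty (S.graph ≃g (⊤ : SimpleGraph (Fin 3))) ∧
        ∀ a b c, S.graph.Adj a b → S.graph.Adj b c → S.graph.Adj c a →
          S.triangleSign a b c = -1) ∧
    -- In the switching class for `K₁,₃`, each member is a triangle, and that triangle is positive.
    (∀ p : EdgeOrientation (completeBipartiteGraph (Fin 1) (Fin 3)),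
      ∀ T ∈ p.antisymmetricLineGraph.switchingClass,
        Nonempty (T.graph ≃g (⊤ : SimpleGraph (Fin 3))) ∧
        ∀ a b c, T.graph.Adj a b → T.graph.Adj b c → T.graph.Adj c a →
          T.triangleSign a b c = 1) ∧
    -- Hence the two classes differ, although both underlying graphs are triangles.
    (∀ (o : EdgeOrientation (⊤ : SimpleGraph (Fin 3)))
      (p : EdgeOrientation (completeBipartiteGraph (Fin 1) (Fin 3))),
      ¬ o.antisymmetricLineGraph.SwitchingIsomorphic p.antisymmetricLineGraph) := by
  refine ⟨?_, fun G H o p h => o.nonempty_induce_iso p h, fun o S hS => o.triangleSign_of_top hS,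
    fun p T hT => p.triangleSign_of_star hT, ?_⟩
  · intro V W _ _ _ _ G H o p hG hH h
    obtain ⟨ψ⟩ := o.nonempty_induce_iso p h
    rw [show {v | ¬ G.IsIsolated v} = Set.univ from Set.eq_univ_of_forall hG,
      show {w | ¬ H.IsIsolated w} = Set.univ from Set.eq_univ_of_forall hH] at ψ
    exact ⟨(G.induceUnivIso.symm.trans ψ).trans H.induceUnivIso⟩
  · rintro o p ⟨S, hS, φ, hφ⟩
    obtain ⟨⟨ψ⟩, hneg⟩ := o.triangleSign_of_top hS
    have hpos := (p.triangleSign_of_star (T := p.antisymmetricLineGraph) .refl).2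
    have hadj : ∀ i j : Fin 3, i ≠ j → S.graph.Adj (ψ.symm i) (ψ.symm j) := fun i j hij =>
      ψ.symm.map_rel_iff.mpr hij
    have h01 := hadj 0 1 (by decide)
    have h12 := hadj 1 2 (by decide)
    have h20 := hadj 2 0 (by decide)
    have hφadj : ∀ a b, S.graph.Adj a b → p.antisymmetricLineGraph.graph.Adj (φ a) (φ b) :=
      fun a b h => by
        change p.antisymmetricLineGraph.adj _ _ ≠ 0
        rw [hφ]
        exact h
    have h1 := hneg _ _ _ h01 h12 h20
    have h2 := hpos _ _ _ (hφadj _ _ h01) (hφadj _ _ h12) (hφadj _ _ h20)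
    simp only [SignedGraph.triangleSign, hφ] at h1 h2
    rw [h1] at h2
    norm_num at h2
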